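/- Let $F$ be a field of characteristic different from $2$ with $|F^\ast/F^{\ast 2}|=2^d$ for some $d\in\mathbb N_0$, and let $n\ge 1$ be an integer. Notation. $I^nF$ is the $n$-th power of the fundamental ideal $IF$ (the classes of even-dimensional forms) of the Witt ring of $F$. $GP_nF$ is the set of quadratic forms over $F$ that are similar to an $n$-fold Pfister form $\langle 1,a_1\rangle\otimes\cdots\otimes\langle 1,a_n\rangle$ with $a_1,\dots,a_n\in F^\ast$. For $\varphi\in I^nF$ let $\mathrm{sl}_n(\varphi)$ be the least $k\in\mathbb N_0$ such that $\varphi\equiv\pi_1+\dots+\pi_k \bmod I^{n+1}F$ for some $\pi_1,\dots,\pi_k\in GP_nF$, and let $\mathrm{sl}_n(F)=\sup_{\varphi\in I^nF}\mathrm{sl}_n(\varphi)\in\mathbb N_0\cup\{\infty\}$. For $m\in\mathbb N_0$ let $D_F(2^m)\subseteq F^\ast$ be the group of nonzero sums of $2^m$ squares, and let $d_m=\dim_{\mathbb F_2}\bigl(F^\ast/\pm D_F(2^m)\bigr)$. The level $s(F)$ is the least $k$ such that $-1$ is a sum of $k$ squares in $F$ (and $\infty$ if there is none). Finally $\binom{a}{b}=0$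 if $b>a$. Then: (a) If $F$ is nonreal with $s(F)=2^s$, then $$\mathrm{sl}_n(F)\le\sum_{m=0}^{\min\{s,n\}}\binom{d_m}{n-m}.$$ (b) If $F$ is formally real, then $$\mathrm{sl}_n(F)\le\sum_{m=0}^{n}\binom{d_m}{n-m}.$$ -/

import Mathlib

universe u

open scoped TensorProduct

noncomputable section

namespace WittTheory

/-! ### Nondegenerate quadratic forms over a field of characteristic different from two -/

section Nondegeneracy

variable {F : Type u} [Field F] [Invertible (2 : F)]
variable {V W : Type u} [AddCommGroup V] [Module F V] [AddCommGroup W] [Module F W]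

theorem nondegenerate_iff_associated (Q : QuadraticForm F V) :
    Q.Nondegenerate ↔ ∀ x, (∀ y, QuadraticMap.associated Q x y = 0) → x = 0 := by
  rw [QuadraticMap.nondegenerate_iff_radical_eq_bot, QuadraticMap.radical_eq_ker_associated,
    Submodule.eq_bot_iff]
  simp only [LinearMap.mem_ker, LinearMap.ext_iff, LinearMap.zero_apply]

theorem nondegenerate_of_equivalent {Q : QuadraticForm F V} {Q' : QuadraticForm F W}
    (h : Q.Equivalent Q') (hQ : Q.Nondegenerate) : Q'.Nondegenerate := by
  obtain ⟨e⟩ := h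
  rw [QuadraticMap.nondegenerate_iff_radical_eq_bot] at hQ ⊢
  rw [← e.map_radical, hQ, Submodule.map_bot]

theorem nondegenerate_zero : (0 : QuadraticForm F PUnit.{u + 1}).Nondegenerate := by
  rw [nondegenerate_iff_associated]
  intro x _
  exact Subsingleton.elim _ _

theorem nondegenerate_prod {Q : QuadraticForm F V} {Q' : QuadraticForm F W}
    (hQ : Q.Nondegenerate) (hQ' : Q'.Nondegenerate) : (Q.prod Q').Nondegenerate := by
  rw [nondegenerate_iff_associated] at *
  rintro ⟨x, x'⟩ h
  refine Prod.ext (hQ x fun y => ?_) (hQ' x' fun y => ?_)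
  · simpa [QuadraticMap.associated_prod] using h (y, 0)
  · simpa [QuadraticMap.associated_prod] using h (0, y)

theorem nondegenerate_tmul [Module.Finite F V] [Module.Finite F W]
    {Q : QuadraticForm F V} {Q' : QuadraticForm F W}
    (hQ : Q.Nondegenerate) (hQ' : Q'.Nondegenerate) : (Q.tmul Q').Nondegenerate := by
  rw [QuadraticMap.nondegenerate_iff_radical_eq_bot, QuadraticMap.radical_eq_ker_associated] at *
  have key : QuadraticMap.associated (Q.tmul Q') =
      (TensorProduct.dualDistribEquiv F V W).toLinearMap ∘ₗ
        TensorProduct.map (QuadraticMap.associated Q) (QuadraticMap.associated Q') := by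
    rw [QuadraticForm.associated_tmul]
    ext x y x' y'
    simp [TensorProduct.dualDistribEquiv, TensorProduct.dualDistribEquivOfBasis, mul_comm]
  rw [key, LinearMap.ker_eq_bot]
  simp only [LinearMap.coe_comp]
  refine (LinearEquiv.injective _).comp ?_
  exact TensorProduct.map_injective_of_flat_flat' _ _
    (LinearMap.ker_eq_bot.mp hQ) (LinearMap.ker_eq_bot.mp hQ')

theorem nondegenerate_smul_sq (a : Fˣ) :
    ((a : F) • (QuadraticMap.sq : QuadraticForm F F)).Nondegenerate := by
  rw [nondegenerate_iff_associated]
  intro x h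
  have := h 1
  simpa using this

end Nondegeneracy

/-- A (finite-dimensional, nondegenerate) quadratic form over `F`. -/
structure QForm (F : Type u) [Field F] where
  /-- the underlying vector space -/
  V : Type u
  [addCommGroup : AddCommGroup V]
  [module : Module F V]
  [finite : Module.Finite F V]
  /-- the quadratic form -/
  form : QuadraticForm F V
  nondegenerate : form.Nondegenerate

attribute [instance] QForm.addCommGroup QForm.module QForm.finite

section Ring

variable (F : Type u) [Field F]

/-- Isometry of quadratic forms. -/
instance QForm.setoid : Setoid (QForm F) where
  r φ ψ := φ.form.Equivalent ψ.form
  iseqv := ⟨fun φ => .refl φ.form, .symm, .trans⟩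

/-- Isometry classes of quadratic forms over `F`. -/
def IsomClass : Type (u + 1) := Quotient (QForm.setoid F)

end Ring

section Semiring

variable {F : Type u} [Field F]

/-- The isometry class of a form. -/
def QForm.toClass (φ : QForm F) : IsomClass F := Quotient.mk _ φ

theorem QForm.toClass_eq {φ ψ : QForm F} (e : φ.form.IsometryEquiv ψ.form) :
    φ.toClass = ψ.toClass := Quotient.sound ⟨e⟩

theorem QForm.toClass_surjective (q : IsomClass F) : ∃ φ : QForm F, φ.toClass = q :=
  Quotient.exists_rep q

/-- The dimension of an isometry class. -/
def IsomClass.dim (q : IsomClass F) : ℕ :=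
  Quotient.lift (fun φ : QForm F => Module.finrank F φ.V)
    (fun φ ψ (h : φ.form.Equivalent ψ.form) => h.elim fun e => e.toLinearEquiv.finrank_eq) q

variable [Invertible (2 : F)]

/-- The zero-dimensional form. -/
def QForm.zero : QForm F := ⟨PUnit, 0, nondegenerate_zero⟩

/-- Orthogonal sum. -/
def QForm.sum (φ ψ : QForm F) : QForm F :=
  ⟨φ.V × ψ.V, φ.form.prod ψ.form, nondegenerate_prod φ.nondegenerate ψ.nondegenerate⟩

/-- Tensor product. -/
def QForm.tensor (φ ψ : QForm F) : QForm F :=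
  ⟨φ.V ⊗[F] ψ.V, φ.form.tmul ψ.form, nondegenerate_tmul φ.nondegenerate ψ.nondegenerate⟩

/-- The one-dimensional form `⟨a⟩ : x ↦ a * x ^ 2`. -/
def QForm.single (a : Fˣ) : QForm F :=
  ⟨F, (a : F) • QuadraticMap.sq, nondegenerate_smul_sq a⟩

/-- The isometry class of the one-dimensional form `⟨a⟩`. -/
def diag (a : Fˣ) : IsomClass F := (QForm.single a).toClass

instance : Zero (IsomClass F) := ⟨QForm.zero.toClass⟩

instance : One (IsomClass F) := ⟨diag 1⟩

/-- Addition of isometry classes is orthogonal sum. -/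
instance : Add (IsomClass F) :=
  ⟨Quotient.map₂ QForm.sum (fun _ _ h _ _ h' => h.prod h')⟩

/-- The tensor product of two isometries. -/
def tmulIsometry {V₁ V₂ W₁ W₂ : Type u} [AddCommGroup V₁] [AddCommGroup V₂] [AddCommGroup W₁]
    [AddCommGroup W₂] [Module F V₁] [Module F V₂] [Module F W₁] [Module F W₂]
    {Q₁ : QuadraticForm F V₁} {Q₂ : QuadraticForm F V₂}
    {R₁ : QuadraticForm F W₁} {R₂ : QuadraticForm F W₂}
    (e : Q₁.IsometryEquiv R₁) (f : Q₂.IsometryEquiv R₂) :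
    (Q₁.tmul Q₂).IsometryEquiv (R₁.tmul R₂) where
  toLinearEquiv := TensorProduct.congr e.toLinearEquiv f.toLinearEquiv
  map_app' := QuadraticForm.tmul_tensorMap_apply e.toIsometry f.toIsometry

/-- Multiplication of isometry classes is tensor product. -/
instance : Mul (IsomClass F) :=
  ⟨Quotient.map₂ QForm.tensor (fun _ _ ⟨e⟩ _ _ ⟨f⟩ => ⟨tmulIsometry e f⟩)⟩

theorem toClass_add (φ ψ : QForm F) : φ.toClass + ψ.toClass = (φ.sum ψ).toClass := rfl

theorem toClass_mul (φ ψ : QForm F) : φ.toClass * ψ.toClass = (φ.tensor ψ).toClass := rfl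

theorem isom_mul_comm (p q : IsomClass F) : p * q = q * p := by
  obtain ⟨φ, rfl⟩ := QForm.toClass_surjective p
  obtain ⟨ψ, rfl⟩ := QForm.toClass_surjective q
  exact QForm.toClass_eq (QuadraticForm.tensorComm φ.form ψ.form)

theorem isom_one_mul (p : IsomClass F) : 1 * p = p := by
  obtain ⟨φ, rfl⟩ := QForm.toClass_surjective p
  have e : (((1 : Fˣ) : F) • (QuadraticMap.sq : QuadraticForm F F)).IsometryEquiv
      (QuadraticMap.sq : QuadraticForm F F) := ⟨LinearEquiv.refl F F, fun m => by simp⟩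
  exact QForm.toClass_eq
    ((tmulIsometry e (QuadraticMap.IsometryEquiv.refl φ.form)).trans
      (QuadraticForm.tensorLId φ.form))

theorem isom_mul_assoc (p q r : IsomClass F) : p * q * r = p * (q * r) := by
  obtain ⟨φ, rfl⟩ := QForm.toClass_surjective p
  obtain ⟨ψ, rfl⟩ := QForm.toClass_surjective q
  obtain ⟨χ, rfl⟩ := QForm.toClass_surjective r
  exact QForm.toClass_eq (QuadraticForm.tensorAssoc φ.form ψ.form χ.form)

theorem isom_mul_add (p q r : IsomClass F) : p * (q + r) = p * q + p * r := by
  obtain ⟨φ, rfl⟩ := QForm.toClass_surjective p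
  obtain ⟨ψ, rfl⟩ := QForm.toClass_surjective q
  obtain ⟨χ, rfl⟩ := QForm.toClass_surjective r
  refine QForm.toClass_eq (φ := φ.tensor (ψ.sum χ)) (ψ := (φ.tensor ψ).sum (φ.tensor χ))
    ⟨TensorProduct.prodRight F F φ.V ψ.V χ.V, fun m => ?_⟩
  suffices h : ((φ.form.tmul ψ.form).prod (φ.form.tmul χ.form)).comp
      (TensorProduct.prodRight F F φ.V ψ.V χ.V).toLinearMap = φ.form.tmul (ψ.form.prod χ.form) from
    DFunLike.congr_fun h m
  refine (QuadraticMap.associated_rightInverse F).injective ?_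
  rw [QuadraticMap.associated_comp, QuadraticMap.associated_prod, QuadraticForm.associated_tmul,
    QuadraticForm.associated_tmul, QuadraticForm.associated_tmul, QuadraticMap.associated_prod]
  ext <;> simp

theorem isom_zero_mul (p : IsomClass F) : 0 * p = 0 := by
  obtain ⟨φ, rfl⟩ := QForm.toClass_surjective p
  have : Subsingleton (PUnit.{u + 1} ⊗[F] φ.V) :=
    ⟨fun x y => by
      have h : ∀ z : PUnit.{u + 1} ⊗[F] φ.V, z = 0 := fun z => by
        induction z with
        | zero => rfl
        | tmul a b => rw [show a = 0 from Subsingleton.elim _ _, TensorProduct.zero_tmul]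
        | add a b ha hb => rw [ha, hb, add_zero]
      rw [h x, h y]⟩
  have e : ((0 : QuadraticForm F PUnit.{u + 1}).tmul φ.form).IsometryEquiv
      (0 : QuadraticForm F PUnit.{u + 1}) :=
    ⟨(0 : (PUnit.{u + 1} ⊗[F] φ.V) ≃ₗ[F] PUnit.{u + 1}), fun m => by
      rw [show m = 0 from Subsingleton.elim _ _, QuadraticMap.map_zero]
      rfl⟩
  exact QForm.toClass_eq (φ := QForm.zero.tensor φ) (ψ := QForm.zero) e

theorem isom_zero_add (p : IsomClass F) : 0 + p = p := by
  obtain ⟨φ, rfl⟩ := QForm.toClass_surjective p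
  have e : ((0 : QuadraticForm F PUnit.{u + 1}).prod φ.form).IsometryEquiv φ.form :=
    ⟨LinearEquiv.uniqueProd, fun m => by simp⟩
  exact QForm.toClass_eq (φ := QForm.zero.sum φ) (ψ := φ) e

theorem isom_add_comm (p q : IsomClass F) : p + q = q + p := by
  obtain ⟨φ, rfl⟩ := QForm.toClass_surjective p
  obtain ⟨ψ, rfl⟩ := QForm.toClass_surjective q
  exact QForm.toClass_eq (QuadraticMap.IsometryEquiv.prodComm φ.form ψ.form)

theorem isom_add_assoc (p q r : IsomClass F) : p + q + r = p + (q + r) := by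
  obtain ⟨φ, rfl⟩ := QForm.toClass_surjective p
  obtain ⟨ψ, rfl⟩ := QForm.toClass_surjective q
  obtain ⟨χ, rfl⟩ := QForm.toClass_surjective r
  have e : ((φ.form.prod ψ.form).prod χ.form).IsometryEquiv
      (φ.form.prod (ψ.form.prod χ.form)) :=
    ⟨LinearEquiv.prodAssoc F φ.V ψ.V χ.V, fun m => by simp [add_assoc]⟩
  exact QForm.toClass_eq (φ := (φ.sum ψ).sum χ) (ψ := φ.sum (ψ.sum χ)) e

/-- The semiring of isometry classes under orthogonal sum and tensor product. -/
instance : CommSemiring (IsomClass F) where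
  add_assoc := isom_add_assoc
  zero_add := isom_zero_add
  add_zero p := by rw [isom_add_comm, isom_zero_add]
  add_comm := isom_add_comm
  nsmul := nsmulRec
  left_distrib := isom_mul_add
  right_distrib p q r := by rw [isom_mul_comm, isom_mul_add, isom_mul_comm r p, isom_mul_comm r q]
  zero_mul := isom_zero_mul
  mul_zero p := by rw [isom_mul_comm, isom_zero_mul]
  mul_assoc := isom_mul_assoc
  one_mul := isom_one_mul
  mul_one p := by rw [isom_mul_comm, isom_one_mul]
  mul_comm := isom_mul_comm

/-- The dimension is a homomorphism of semirings. -/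
def dimHom : IsomClass F →+* ℕ where
  toFun := IsomClass.dim
  map_zero' := Module.finrank_zero_of_subsingleton (R := F) (M := PUnit.{u + 1})
  map_one' := Module.finrank_self F
  map_add' p q := by
    obtain ⟨φ, rfl⟩ := QForm.toClass_surjective p
    obtain ⟨ψ, rfl⟩ := QForm.toClass_surjective q
    exact Module.finrank_prod (R := F) (M := φ.V) (M' := ψ.V)
  map_mul' p q := by
    obtain ⟨φ, rfl⟩ := QForm.toClass_surjective p
    obtain ⟨ψ, rfl⟩ := QForm.toClass_surjective q
    exact Module.finrank_tensorProduct (R := F) (S := F) (M := φ.V) (M' := ψ.V)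

/-- The class of the hyperbolic plane `⟨1, -1⟩`. -/
def hyp : IsomClass F := diag 1 + diag (-1)

theorem diag_mul_diag (a b : Fˣ) : diag a * diag b = diag (a * b) := by
  refine QForm.toClass_eq (φ := (QForm.single a).tensor (QForm.single b))
    (ψ := QForm.single (a * b)) ⟨TensorProduct.lid F F, fun m => ?_⟩
  suffices h : (((a * b : Fˣ) : F) • (QuadraticMap.sq : QuadraticForm F F)).comp
      (TensorProduct.lid F F).toLinearMap =
      QuadraticForm.tmul ((a : F) • (QuadraticMap.sq : QuadraticForm F F))
        ((b : F) • (QuadraticMap.sq : QuadraticForm F F)) from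
    DFunLike.congr_fun h m
  refine (QuadraticMap.associated_rightInverse F).injective ?_
  rw [QuadraticMap.associated_comp, QuadraticForm.associated_tmul]
  ext
  simp [mul_comm]

/-- The change of coordinates between `⟨a, -a⟩` and `⟨1, -1⟩`. -/
def hypEquiv (a : Fˣ) : (F × F) ≃ₗ[F] (F × F) where
  toFun v := ((a * (v.1 - v.2) + (v.1 + v.2)) / 2, (a * (v.1 - v.2) - (v.1 + v.2)) / 2)
  map_add' v w := by
    ext <;> simp <;> ring
  map_smul' c v := by
    ext <;> simp <;> ring
  invFun w := (((w.1 + w.2) / a + (w.1 - w.2)) / 2, ((w.1 - w.2) - (w.1 + w.2) / a) / 2)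
  left_inv v := by
    have h2 : (2 : F) ≠ 0 := Invertible.ne_zero 2
    have ha : (a : F) ≠ 0 := a.ne_zero
    ext <;> simp <;> field_simp <;> ring
  right_inv v := by
    have h2 : (2 : F) ≠ 0 := Invertible.ne_zero 2
    have ha : (a : F) ≠ 0 := a.ne_zero
    ext <;> simp <;> field_simp <;> ring

theorem hypEquiv_apply (a : Fˣ) (v : F × F) : (hypEquiv a v).1 * (hypEquiv a v).1 -
    (hypEquiv a v).2 * (hypEquiv a v).2 = a * (v.1 * v.1) - a * (v.2 * v.2) := by
  have h2 : (2 : F) ≠ 0 := Invertible.ne_zero 2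
  simp only [hypEquiv, LinearEquiv.coe_mk, LinearMap.coe_mk, AddHom.coe_mk]
  field_simp
  ring

/-- `⟨a, -a⟩` is a hyperbolic plane. -/
theorem diag_mul_hyp (a : Fˣ) : diag a * hyp = hyp := by
  rw [hyp, mul_add, diag_mul_diag, diag_mul_diag, mul_one]
  have e : (((a : F) • (QuadraticMap.sq : QuadraticForm F F)).prod
      (((a * -1 : Fˣ) : F) • (QuadraticMap.sq : QuadraticForm F F))).IsometryEquiv
      ((((1 : Fˣ) : F) • (QuadraticMap.sq : QuadraticForm F F)).prod
        (((-1 : Fˣ) : F) • (QuadraticMap.sq : QuadraticForm F F))) :=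
    ⟨hypEquiv a, fun v => by
      have h := hypEquiv_apply a v
      simp
      linear_combination h⟩
  exact QForm.toClass_eq (φ := (QForm.single a).sum (QForm.single (a * -1)))
    (ψ := (QForm.single 1).sum (QForm.single (-1))) e

/-- Every diagonal form is an orthogonal sum of one-dimensional forms. -/
theorem exists_weighted : ∀ (n : ℕ) (w : Fin n → Fˣ), ∃ ψ : QForm F,
    ψ.form.Equivalent (QuadraticMap.weightedSumSquares F w) ∧ ψ.toClass = ∑ i, diag (w i)
  | 0, w => by
    have e : (0 : QuadraticForm F PUnit.{u + 1}).IsometryEquiv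
        (QuadraticMap.weightedSumSquares F w) :=
      ⟨(0 : PUnit.{u + 1} ≃ₗ[F] (Fin 0 → F)), fun m => by
        simp [QuadraticMap.weightedSumSquares_apply]⟩
    exact ⟨QForm.zero, ⟨e⟩, by rw [Finset.univ_eq_empty, Finset.sum_empty]; rfl⟩
  | n + 1, w => by
    obtain ⟨ψ, ⟨e⟩, h⟩ := exists_weighted n (fun i => w i.succ)
    have e' : (((w 0 : F) • (QuadraticMap.sq : QuadraticForm F F)).prod ψ.form).IsometryEquiv
        (QuadraticMap.weightedSumSquares F w) :=
      ⟨(LinearEquiv.prodCongr (LinearEquiv.refl F F) e.toLinearEquiv).trans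
        (Fin.consLinearEquiv F (fun _ => F)), fun m => by
        have := e.map_app m.2
        rw [QuadraticMap.weightedSumSquares_apply] at this
        simp [QuadraticMap.weightedSumSquares_apply, Fin.sum_univ_succ, ← this, Units.smul_def]⟩
    refine ⟨(QForm.single (w 0)).sum ψ, ⟨e'⟩, ?_⟩
    rw [Fin.sum_univ_succ, ← h]
    rfl

/-- Every form can be diagonalized. -/
theorem exists_diag (q : IsomClass F) : ∃ w : Fin q.dim → Fˣ, q = ∑ i, diag (w i) := by
  obtain ⟨φ, rfl⟩ := QForm.toClass_surjective q
  have hs : (QuadraticMap.associated (R := F) φ.form).SeparatingLeft := by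
    have h := (nondegenerate_iff_associated φ.form).mp φ.nondegenerate
    exact h
  obtain ⟨w, ⟨e⟩⟩ := φ.form.equivalent_weightedSumSquares_units_of_nondegenerate' hs
  obtain ⟨ψ, ⟨e'⟩, h⟩ := exists_weighted _ w
  exact ⟨w, (QForm.toClass_eq (e.trans e'.symm)).trans h⟩

theorem mul_hyp (q : IsomClass F) : q * hyp = q.dim • hyp := by
  obtain ⟨w, hw⟩ := exists_diag q
  conv_lhs => rw [hw]
  simp [Finset.sum_mul, diag_mul_hyp]

/-- Witt equivalence: `φ ⊥ iℍ ≅ ψ ⊥ jℍ` for some `i` and `j`. It is compatible with orthogonal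
sums and tensor products. -/
def wittCon (F : Type u) [Field F] [Invertible (2 : F)] : RingCon (IsomClass F) where
  r p q := ∃ i j : ℕ, p + i • hyp = q + j • hyp
  iseqv :=
    { refl := fun p => ⟨0, 0, rfl⟩
      symm := fun ⟨i, j, h⟩ => ⟨j, i, h.symm⟩
      trans := fun {p q r} ⟨i, j, h⟩ ⟨k, l, h'⟩ => ⟨i + k, l + j, by
        rw [add_smul, add_smul, ← add_assoc, ← add_assoc, h, ← h', add_right_comm]⟩ }
  add' := fun {p q r s} ⟨i, j, h⟩ ⟨k, l, h'⟩ => ⟨i + k, j + l, by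
    rw [add_smul, add_smul, add_add_add_comm, add_add_add_comm q, h, h']⟩
  mul' := fun {p q r s} ⟨i, j, h⟩ ⟨k, l, h'⟩ => by
    have key : ∀ (p r : IsomClass F) (i k : ℕ), ∃ m : ℕ,
        (p + i • hyp) * (r + k • hyp) = p * r + m • hyp := fun p r i k =>
      ⟨k * p.dim + i * r.dim + i * (k * (hyp : IsomClass F).dim), by
        have h1 := mul_hyp p
        have h2 := mul_hyp r
        have h3 := mul_hyp (hyp : IsomClass F)
        simp only [nsmul_eq_mul] at h1 h2 h3 ⊢
        push_cast
        calc (p + (i : IsomClass F) * hyp) * (r + (k : IsomClass F) * hyp)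
            = p * r + (k : IsomClass F) * (p * hyp) + (i : IsomClass F) * (r * hyp) +
              (i : IsomClass F) * ((k : IsomClass F) * (hyp * hyp)) := by ring
          _ = _ := by rw [h1, h2, h3]; ring⟩
    obtain ⟨m, hm⟩ := key p r i k
    obtain ⟨m', hm'⟩ := key q s j l
    exact ⟨m, m', by rw [← hm, ← hm', h, h']⟩

/-- The Witt ring of `F`. -/
def WittRing (F : Type u) [Field F] [Invertible (2 : F)] : Type (u + 1) := (wittCon F).Quotient

instance : CommSemiring (WittRing F) := inferInstanceAs (CommSemiring (wittCon F).Quotient)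

/-- The Witt class of (the isometry class of) a form. -/
def toWitt : IsomClass F →+* WittRing F := (wittCon F).mk'

theorem toWitt_surjective : Function.Surjective (toWitt : IsomClass F → WittRing F) :=
  (wittCon F).mk'_surjective

theorem toWitt_eq_iff (p q : IsomClass F) :
    toWitt p = toWitt q ↔ ∃ i j : ℕ, p + i • hyp = q + j • hyp :=
  (wittCon F).eq

theorem toWitt_hyp : toWitt (hyp : IsomClass F) = 0 := by
  rw [← map_zero toWitt, toWitt_eq_iff]
  exact ⟨0, 1, by simp⟩

/-- The negative of the class of `φ` is that of `⟨-1⟩ ⊗ φ = -φ`. -/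
instance : Neg (WittRing F) := ⟨fun x => toWitt (diag (-1)) * x⟩

/-- The Witt ring is a commutative ring. -/
instance : CommRing (WittRing F) where
  zsmul := zsmulRec
  neg_add_cancel x := by
    change toWitt (diag (-1)) * x + x = 0
    have h := toWitt_hyp (F := F)
    rw [hyp, map_add, show toWitt (diag (1 : Fˣ)) = 1 from map_one toWitt] at h
    calc toWitt (diag (-1)) * x + x = (1 + toWitt (diag (-1))) * x := by ring
      _ = 0 := by rw [h, zero_mul]
  mul_comm := mul_comm

/-- The dimension index `WittRing F → ℤ/2`. -/
def dimIndex : WittRing F →+* ZMod 2 :=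
  (wittCon F).lift ((Nat.castRingHom (ZMod 2)).comp dimHom) (by
    rintro p q ⟨i, j, h⟩
    have hh : ((dimHom (hyp : IsomClass F) : ℕ) : ZMod 2) = 0 := by
      have h1 : dimHom (diag (1 : Fˣ)) = 1 := Module.finrank_self F
      have h2 : dimHom (diag (-1 : Fˣ)) = 1 := Module.finrank_self F
      rw [hyp, map_add, h1, h2]
      rfl
    have := congrArg ((Nat.castRingHom (ZMod 2)).comp dimHom) h
    simpa [hh] using this)

/-- The fundamental ideal `IF`: the Witt classes of even-dimensional forms. -/
def fundIdeal (F : Type u) [Field F] [Invertible (2 : F)] : Ideal (WittRing F) :=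
  RingHom.ker dimIndex

/-! ### Pfister forms and symbol length -/

/-- The isometry class of the `n`-fold Pfister form `⟨⟨a₁, …, aₙ⟩⟩ = ⟨1, a₁⟩ ⊗ ⋯ ⊗ ⟨1, aₙ⟩`. -/
def pfister {n : ℕ} (a : Fin n → Fˣ) : IsomClass F := ∏ i, (diag 1 + diag (a i))

/-- `GPₙF`: the isometry classes of forms similar to some `n`-fold Pfister form. -/
def GP (F : Type u) [Field F] [Invertible (2 : F)] (n : ℕ) : Set (IsomClass F) :=
  {q | ∃ (c : Fˣ) (a : Fin n → Fˣ), q = diag c * pfister a}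

/-- `φ` is congruent modulo `Iⁿ⁺¹F` to a sum of `k` elements of `GPₙF`. -/
def IsSumOfSymbols (n k : ℕ) (φ : WittRing F) : Prop :=
  ∃ π : Fin k → IsomClass F, (∀ i, π i ∈ GP F n) ∧
    φ - ∑ i, toWitt (π i) ∈ fundIdeal F ^ (n + 1)

/-- The `n`-symbol length of a Witt class. -/
def symbolLength (n : ℕ) (φ : WittRing F) : ℕ∞ :=
  ⨅ (k : ℕ) (_ : IsSumOfSymbols n k φ), (k : ℕ∞)

/-- The `n`-symbol length of `F`: the supremum of the symbol lengths of the elements of `IⁿF`. -/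
def fieldSymbolLength (F : Type u) [Field F] [Invertible (2 : F)] (n : ℕ) : ℕ∞ :=
  ⨆ φ ∈ fundIdeal F ^ n, symbolLength n φ

end Semiring

/-! ### Sums of squares -/

section SumsOfSquares

variable (F : Type u) [Field F]

/-- The level `s(F)`: the least `k` such that `-1` is a sum of `k` squares in `F`, or `∞`. -/
def level : ℕ∞ := ⨅ (k : ℕ) (_ : ∃ x : Fin k → F, -1 = ∑ i, x i ^ 2), (k : ℕ∞)

variable {F}

open Matrix in
/-- A sum `c` of `2 ^ m` squares admits a square matrix `T` of size `2 ^ m` with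
`T Tᵀ = Tᵀ T = c`. -/
theorem exists_similitude (m : ℕ) (x : Fin (2 ^ m) → F) :
    ∃ T : Matrix (Fin (2 ^ m)) (Fin (2 ^ m)) F,
      T * Tᵀ = (∑ i, x i ^ 2) • 1 ∧ Tᵀ * T = (∑ i, x i ^ 2) • 1 := by
  induction m with
  | zero =>
    have hs : Subsingleton (Fin (2 ^ 0)) := inferInstanceAs (Subsingleton (Fin 1))
    have h : ∑ i, x i ^ 2 = x 0 ^ 2 := Fintype.sum_subsingleton _ _
    rw [h]
    refine ⟨Matrix.diagonal fun _ => x 0, ?_, ?_⟩ <;>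
    · rw [Matrix.diagonal_transpose, Matrix.diagonal_mul_diagonal, Matrix.smul_one_eq_diagonal]
      simp only [sq]
  | succ m ih =>
    have hpow : 2 ^ m + 2 ^ m = 2 ^ (m + 1) := by ring
    let e : Fin (2 ^ m) ⊕ Fin (2 ^ m) ≃ Fin (2 ^ (m + 1)) := finSumFinEquiv.trans (finCongr hpow)
    obtain ⟨A, hA, hA'⟩ := ih (fun i => x (e (.inl i)))
    obtain ⟨B, hB, hB'⟩ := ih (fun i => x (e (.inr i)))
    have hsum : ∑ i, x i ^ 2 = ∑ i, x (e (.inl i)) ^ 2 + ∑ i, x (e (.inr i)) ^ 2 := by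
      rw [← e.sum_comp, Fintype.sum_sum_type]
    rw [hsum]
    generalize ∑ i, x (e (.inl i)) ^ 2 = a at *
    generalize ∑ i, x (e (.inr i)) ^ 2 = b at *
    suffices h : ∃ T : Matrix (Fin (2 ^ m) ⊕ Fin (2 ^ m)) (Fin (2 ^ m) ⊕ Fin (2 ^ m)) F,
        T * Tᵀ = (a + b) • 1 by
      obtain ⟨T, hT⟩ := h
      suffices h : ∃ T : Matrix (Fin (2 ^ m) ⊕ Fin (2 ^ m)) (Fin (2 ^ m) ⊕ Fin (2 ^ m)) F,
          T * Tᵀ = (a + b) • 1 ∧ Tᵀ * T = (a + b) • 1 by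
        obtain ⟨T, hT, hT'⟩ := h
        refine ⟨T.submatrix e.symm e.symm, ?_, ?_⟩
        · rw [transpose_submatrix, submatrix_mul_equiv, hT, submatrix_smul]
          simp
        · rw [transpose_submatrix, submatrix_mul_equiv, hT', submatrix_smul]
          simp
      by_cases hc : a + b = 0
      · exact ⟨0, by simp [hc], by simp [hc]⟩
      · refine ⟨T, hT, ?_⟩
        have h1 : T * ((a + b)⁻¹ • Tᵀ) = 1 := by
          rw [Matrix.mul_smul, hT, smul_smul, inv_mul_cancel₀ hc, one_smul]
        have h2 := mul_eq_one_comm.mp h1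
        rw [Matrix.smul_mul] at h2
        rw [← h2, smul_smul, mul_inv_cancel₀ hc, one_smul]
    have main : ∀ (a b : F) (A B : Matrix (Fin (2 ^ m)) (Fin (2 ^ m)) F), a ≠ 0 →
        A * Aᵀ = a • 1 → Aᵀ * A = a • 1 → B * Bᵀ = b • 1 → Bᵀ * B = b • 1 →
        ∃ T : Matrix (Fin (2 ^ m) ⊕ Fin (2 ^ m)) (Fin (2 ^ m) ⊕ Fin (2 ^ m)) F,
          T * Tᵀ = (a + b) • 1 := by
      intro a b A B ha hA hA' hB hB'
      refine ⟨fromBlocks A B (-a⁻¹ • (Aᵀ * Bᵀ * A)) Aᵀ, ?_⟩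
      rw [fromBlocks_transpose, fromBlocks_multiply, ← fromBlocks_one, fromBlocks_smul]
      have e1 : A * (Aᵀ * (B * A)) = a • (B * A) := by
        rw [← Matrix.mul_assoc, hA]; simp
      have e2 : Aᵀ * (Bᵀ * (A * Aᵀ)) = a • (Aᵀ * Bᵀ) := by
        rw [hA]; simp
      have e3 : Aᵀ * (Bᵀ * (A * (Aᵀ * (B * A)))) = (a * (b * a)) • 1 := by
        rw [e1, Matrix.mul_smul, Matrix.mul_smul, ← Matrix.mul_assoc Bᵀ, hB']
        simp [hA', smul_smul]
      congr 1
      · rw [hA, hB, add_smul]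
      · simp [Matrix.mul_assoc, e1, smul_smul, ha]
      · simp [Matrix.mul_assoc, e2, smul_smul, ha]
      · simp only [transpose_smul, transpose_mul, transpose_transpose, Matrix.smul_mul,
          Matrix.mul_smul, Matrix.mul_assoc, e3, hA', smul_smul, ← add_smul]
        congr 1
        field_simp
        ring
    by_cases ha : a = 0
    · by_cases hb : b = 0
      · exact ⟨0, by simp [ha, hb]⟩
      · rw [add_comm]
        exact main b a B A hb hB hB' hA hA'
    · exact main a b A B ha hA hA' hB hB'

open Matrix in
/-- The product of two sums of `2 ^ m` squares is a sum of `2 ^ m` squares. -/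
theorem sum_sq_mul_sum_sq (m : ℕ) (x y : Fin (2 ^ m) → F) :
    ∃ z : Fin (2 ^ m) → F, (∑ i, x i ^ 2) * (∑ i, y i ^ 2) = ∑ i, z i ^ 2 := by
  obtain ⟨T, -, hT⟩ := exists_similitude m x
  refine ⟨T *ᵥ y, ?_⟩
  have h : ∀ v : Fin (2 ^ m) → F, ∑ i, v i ^ 2 = v ⬝ᵥ v := fun v => by
    simp [dotProduct, sq]
  rw [h (T *ᵥ y), Matrix.dotProduct_mulVec, Matrix.vecMul_mulVec, h y]
  rw [hT, Matrix.vecMul_smul, Matrix.vecMul_one, smul_dotProduct, smul_eq_mul]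

variable (F)

/-- `D_F(2 ^ m)`: the group of nonzero sums of `2 ^ m` squares. -/
def sumsOfSquares (m : ℕ) : Subgroup Fˣ where
  carrier := {c | ∃ x : Fin (2 ^ m) → F, (c : F) = ∑ i, x i ^ 2}
  one_mem' := ⟨Pi.single ⟨0, by positivity⟩ 1, by
    rw [Finset.sum_eq_single ⟨0, by positivity⟩] <;> simp +contextual⟩
  mul_mem' := by
    rintro c d ⟨x, hx⟩ ⟨y, hy⟩
    obtain ⟨z, hz⟩ := sum_sq_mul_sum_sq m x y
    exact ⟨z, by rw [Units.val_mul, hx, hy, hz]⟩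
  inv_mem' := by
    rintro c ⟨x, hx⟩
    refine ⟨fun i => x i * (c : F)⁻¹, ?_⟩
    simp_rw [mul_pow]
    rw [← Finset.sum_mul, ← hx, Units.val_inv_eq_inv_val]
    field_simp

/-- `±D_F(2 ^ m)`. -/
def pmSumsOfSquares (m : ℕ) : Subgroup Fˣ where
  carrier := {c | c ∈ sumsOfSquares F m ∨ -c ∈ sumsOfSquares F m}
  one_mem' := .inl (one_mem _)
  mul_mem' := by
    rintro c d (hc | hc) (hd | hd)
    · exact .inl (mul_mem hc hd)
    · exact .inr (by simpa using mul_mem hc hd)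
    · exact .inr (by simpa using mul_mem hc hd)
    · exact .inl (by simpa using mul_mem hc hd)
  inv_mem' := by
    rintro c (hc | hc)
    · exact .inl (inv_mem hc)
    · exact .inr (by simpa using inv_mem hc)

theorem sq_mem_pmSumsOfSquares (m : ℕ) (c : Fˣ) : c ^ 2 ∈ pmSumsOfSquares F m :=
  .inl ⟨Pi.single ⟨0, by positivity⟩ (c : F), by
    rw [Finset.sum_eq_single ⟨0, by positivity⟩] <;> simp +contextual⟩

/-- `F^× / ±D_F(2 ^ m)` is an elementary abelian `2`-group, that is, an `𝔽₂`-vector space. -/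
instance (m : ℕ) : Module (ZMod 2) (Additive (Fˣ ⧸ pmSumsOfSquares F m)) :=
  AddCommGroup.zmodModule (n := 2) (G := Additive (Fˣ ⧸ pmSumsOfSquares F m)) (by
    intro x
    change Additive.ofMul ((x.toMul : Fˣ ⧸ pmSumsOfSquares F m) ^ 2) = 0
    obtain ⟨c, hc⟩ := QuotientGroup.mk_surjective x.toMul
    rw [← hc, ← QuotientGroup.mk_pow, ofMul_eq_zero, QuotientGroup.eq_one_iff]
    exact sq_mem_pmSumsOfSquares F m c)

/-- `d_m = dim_{𝔽₂} (F^× / ±D_F(2 ^ m))`. -/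
def dInv (m : ℕ) : ℕ := Module.finrank (ZMod 2) (Additive (Fˣ ⧸ pmSumsOfSquares F m))

end SumsOfSquares

end WittTheory

end

/-! Write `symb a` for the Witt class of ⟨1, -a⟩; in particular `symb (-1) = 2`. If a finite set E
generates F^× modulo ±F^{×2}, then IF is generated as an ideal by 2 and the `symb e`, e ∈ E. Since
(`symb e`)² = 2 `symb e`, a repeated factor can be traded for a 2, so IⁿF is generated by the
products 2^m ∏_{e ∈ S} `symb e` with S ⊆ E and m + |S| = n (`fundIdeal_pow_le_span`).

Most of these vanish: 2^m × ⟨1⟩ is a Pfister form, so every a ∈ D_F(2^m) is a similarity factor of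
it and 2^m `symb a` = 0 (`two_pow_mul_symb`). Only the S disjoint from D_F(2^m) survive. Lifting
bases along the chain ±D_F(2^m) produces an E with at most d_m elements outside D_F(2^m) for every m
≤ n (`exists_adapted_generators`), which leaves at most binom(d_m, n - m) products for each m. If
s(F) = 2^s, then 2^(s+1) = 0 in the Witt ring and the terms with m > s drop out.

Finally WF/IF = 𝔽₂, so modulo Iⁿ⁺¹F every element of IⁿF is a sum of distinct surviving products,
each the class of an n-fold Pfister form (`fieldSymbolLength_le_of_generators`). -/

noncomputable section
namespace WittTheory

/-! ### Relations between the classes ⟨1, -a⟩ in the Witt ring -/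

section SymbolGenerators

variable {F : Type u} [Field F] [Invertible (2 : F)]

theorem toWitt_diag_one : toWitt (diag (1 : Fˣ)) = (1 : WittRing F) := map_one toWitt

theorem toWitt_diag_mul (a b : Fˣ) :
    toWitt (diag (a * b)) = toWitt (diag a) * toWitt (diag b) := by
  rw [← map_mul, diag_mul_diag]

theorem toWitt_diag_neg (a : Fˣ) : toWitt (diag (-a)) = -toWitt (diag a) := by
  rw [← neg_one_mul, toWitt_diag_mul]
  rfl

/-- The isometry class of `⟨a⟩` depends only on the square class of `a`. -/
theorem diag_sq (a : Fˣ) : diag (a ^ 2) = diag 1 := by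
  refine QForm.toClass_eq (φ := QForm.single (a ^ 2)) (ψ := QForm.single 1)
    ⟨LinearEquiv.smulOfUnit a, fun x => ?_⟩
  have h : ∀ y : F, ((1 : Fˣ) : F) * ((a : F) * y * (a * y)) = ((a ^ 2 : Fˣ) : F) * (y * y) := by
    intro y
    push_cast
    ring
  exact h x

/-- The Witt class of the one-fold Pfister form `⟨1, -a⟩`. -/
def symb (a : Fˣ) : WittRing F := 1 - toWitt (diag a)

theorem symb_one : symb (1 : Fˣ) = 0 := by rw [symb, toWitt_diag_one, sub_self]

theorem symb_neg_one : symb (-1 : Fˣ) = 2 := by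
  rw [symb, toWitt_diag_neg, toWitt_diag_one]
  ring

/-- This identity makes the units with `symb a` in a fixed ideal closed under products, so ideal
membership need only be checked on group generators of F^×. -/
theorem symb_mul (a b : Fˣ) : symb (a * b) = symb a + symb b - symb a * symb b := by
  simp only [symb, toWitt_diag_mul]
  ring

theorem symb_inv (a : Fˣ) : symb a⁻¹ = symb a := by
  have h : diag (a⁻¹) = diag a := by
    rw [← mul_one (diag a⁻¹), show (1 : IsomClass F) = diag (a ^ 2) from (diag_sq a).symm,
      diag_mul_diag]
    congr 1
    group
  rw [symb, h, symb]

/-- Follows from ⟨a⟩² = 1. It is used to replace a repeated symbol by a factor 2. -/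
theorem symb_mul_self (a : Fˣ) : symb a * symb a = 2 * symb a := by
  have h : toWitt (diag a) * toWitt (diag a) = 1 := by
    rw [← toWitt_diag_mul, ← sq, diag_sq, toWitt_diag_one]
  simp only [symb]
  linear_combination h

theorem symb_eq_toWitt (a : Fˣ) : symb a = toWitt (diag 1 + diag (-a)) := by
  rw [map_add, toWitt_diag_neg, toWitt_diag_one, symb, sub_eq_add_neg]

theorem symb_mem_fundIdeal (a : Fˣ) : symb a ∈ fundIdeal F := by
  rw [fundIdeal, RingHom.mem_ker, symb, map_sub, map_one]
  have : dimIndex (toWitt (diag a)) = 1 := by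
    change (((Module.finrank F F : ℕ)) : ZMod 2) = 1
    simp
  rw [this, sub_self]

/-- The units `a` for which `⟨1, -a⟩` lies in a given ideal form a group. -/
def symbSubgroup (J : Ideal (WittRing F)) : Subgroup Fˣ where
  carrier := {a | symb a ∈ J}
  one_mem' := by simp [symb_one]
  mul_mem' {a b} ha hb := by
    change symb (a * b) ∈ J
    rw [symb_mul]
    exact J.sub_mem (J.add_mem ha hb) (J.mul_mem_left _ hb)
  inv_mem' {a} ha := by simpa [symb_inv] using ha

/-- The residue ring WF/IF is 𝔽₂, so coefficients modulo IF can be taken to be 0 or 1. -/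
theorem mem_fundIdeal_or (x : WittRing F) : x ∈ fundIdeal F ∨ x - 1 ∈ fundIdeal F := by
  simp only [fundIdeal, RingHom.mem_ker, map_sub, map_one]
  generalize dimIndex x = y
  revert y
  decide

/-- An ideal containing all `⟨1, -a⟩` contains the fundamental ideal. -/
theorem fundIdeal_le_of_forall_symb_mem {J : Ideal (WittRing F)} (hJ : ∀ a : Fˣ, symb a ∈ J) :
    fundIdeal F ≤ J := by
  intro x hx
  obtain ⟨q, rfl⟩ := toWitt_surjective x
  obtain ⟨w, hw⟩ := exists_diag q
  have hd : Even q.dim := by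
    have h : ((q.dim : ℕ) : ZMod 2) = 0 := hx
    rwa [ZMod.natCast_eq_zero_iff_even] at h
  obtain ⟨k, hk⟩ := hd
  have h2 : (2 : WittRing F) ∈ J := symb_neg_one (F := F) ▸ hJ (-1)
  -- Since q has 2k diagonal entries, subtracting each `symb (w i) = 1 - ⟨w i⟩` from 2k leaves ∑ ⟨w
  -- i⟩.
  have h : toWitt q = (k : WittRing F) * 2 - ∑ i, symb (w i) := by
    have hs : toWitt q = ∑ i, toWitt (diag (w i)) := by rw [← map_sum, ← hw]
    have : ∑ i, symb (w i) = (q.dim : WittRing F) - toWitt q := by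
      rw [hs]
      simp [symb]
    rw [this, hk]
    push_cast
    ring
  rw [h]
  exact J.sub_mem (J.mul_mem_left _ h2) (J.sum_mem fun i _ => hJ _)

open Matrix in
/-- Similarity factors of `2 ^ m × ⟨1⟩`: nonzero sums of `2 ^ m` squares. -/
theorem nsmul_diag_eq_of_mem_sumsOfSquares {m : ℕ} {a : Fˣ} (ha : a ∈ sumsOfSquares F m) :
    (2 ^ m) • diag a = (2 ^ m) • diag (1 : Fˣ) := by
  obtain ⟨x, hx⟩ := ha
  obtain ⟨T, hT, hT'⟩ := exists_similitude m x
  rw [← hx] at hT hT'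
  obtain ⟨ψ, ⟨e⟩, h⟩ := exists_weighted (2 ^ m) (fun _ => a)
  obtain ⟨ψ', ⟨e'⟩, h'⟩ := exists_weighted (2 ^ m) (fun _ => (1 : Fˣ))
  simp only [Finset.sum_const, Finset.card_univ, Fintype.card_fin] at h h'
  rw [← h, ← h']
  -- The isometry is v ↦ Tv: Tᵀ T = a gives (Tv)·(Tv) = a (v·v), and T has inverse a⁻¹Tᵀ.
  have h1 : T * ((a : F)⁻¹ • Tᵀ) = 1 := by
    rw [Matrix.mul_smul, hT, smul_smul, inv_mul_cancel₀ a.ne_zero, one_smul]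
  have h2 : ((a : F)⁻¹ • Tᵀ) * T = 1 := mul_eq_one_comm.mp h1
  have hf : (QuadraticMap.weightedSumSquares F (fun _ : Fin (2 ^ m) => a)).IsometryEquiv
      (QuadraticMap.weightedSumSquares F (fun _ : Fin (2 ^ m) => (1 : Fˣ))) :=
    ⟨Matrix.toLin'OfInv h2 h1, fun v => by
      have hv : ∀ (c : Fˣ) (v : Fin (2 ^ m) → F),
          QuadraticMap.weightedSumSquares F (fun _ : Fin (2 ^ m) => c) v = c * (v ⬝ᵥ v) := by
        intro c v
        simp [QuadraticMap.weightedSumSquares_apply, dotProduct, Finset.mul_sum, Units.smul_def]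
      have hw : (Matrix.toLin'OfInv h2 h1) v = T *ᵥ v := by
        rw [← Matrix.toLin'_apply]
        rfl
      change QuadraticMap.weightedSumSquares F (fun _ : Fin (2 ^ m) => (1 : Fˣ))
        ((Matrix.toLin'OfInv h2 h1) v) = _
      rw [hw, hv, hv, Matrix.dotProduct_mulVec, Matrix.vecMul_mulVec, hT', Matrix.vecMul_smul,
        Matrix.vecMul_one, smul_dotProduct, smul_eq_mul, Units.val_one, one_mul]⟩
  exact QForm.toClass_eq ((e.trans hf).trans e'.symm)

theorem two_pow_mul_symb {m : ℕ} {a : Fˣ} (ha : a ∈ sumsOfSquares F m) :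
    (2 : WittRing F) ^ m * symb a = 0 := by
  have h := congrArg toWitt (nsmul_diag_eq_of_mem_sumsOfSquares ha)
  rw [map_nsmul, map_nsmul, toWitt_diag_one, nsmul_eq_mul, nsmul_eq_mul] at h
  push_cast at h
  rw [symb, mul_sub, h, sub_self]

-- Apply `two_pow_mul_symb` to -1 ∈ D_F(2^s) and use `symb (-1) = 2`.
variable (F) in
theorem two_pow_eq_zero_of_level {s : ℕ} (hs : level F = 2 ^ s) :
    (2 : WittRing F) ^ (s + 1) = 0 := by
  have h : (-1 : Fˣ) ∈ sumsOfSquares F s := by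
    by_contra hc
    -- A representation of -1 by k ≤ 2^s squares could be padded with zeros to length 2^s, so
    -- otherwise every admissible k exceeds 2^s.
    have : ((2 ^ s + 1 : ℕ) : ℕ∞) ≤ level F := by
      refine le_iInf₂ fun k hk => ?_
      obtain ⟨x, hx⟩ := hk
      by_contra! hlt
      have hle : k ≤ 2 ^ s := by
        have := ENat.natCast_lt_natCast.mp hlt
        omega
      obtain ⟨r, hr⟩ := Nat.exists_eq_add_of_le hle
      refine hc ⟨fun i => Fin.append x (0 : Fin r → F) (Fin.cast hr i), ?_⟩
      rw [Units.val_neg, Units.val_one, hx, ← (finCongr hr).symm.sum_comp, Fin.sum_univ_add]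
      simp
    rw [hs] at this
    have h' : 2 ^ s + 1 ≤ 2 ^ s := by exact_mod_cast this
    omega
  have := two_pow_mul_symb h
  rwa [symb_neg_one, ← pow_succ] at this

end SymbolGenerators

/-! ### Generators of IⁿF and the count of surviving products -/

section Span

variable {F : Type u} [Field F] [Invertible (2 : F)]

/-- Products of `k` factors that are `2` or distinct symbols `⟨1, -e⟩` with `e ∈ E`. -/
def symbolGens (E : Finset Fˣ) (k : ℕ) : Set (WittRing F) :=
  {x | ∃ (m : ℕ) (S : Finset Fˣ), S ⊆ E ∧ m + S.card = k ∧ x = 2 ^ m * ∏ e ∈ S, symb e}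

/-- D_F(1) consists of the squares, whose symbols vanish; the sign is accounted for by the generator
2. -/
theorem fundIdeal_le_span {E : Finset Fˣ}
    (hE : Subgroup.closure (E : Set Fˣ) ⊔ pmSumsOfSquares F 0 = ⊤) :
    fundIdeal F ≤ Ideal.span (insert 2 (symb '' (E : Set Fˣ))) := by
  set J : Ideal (WittRing F) := Ideal.span (insert 2 (symb '' (E : Set Fˣ))) with hJ
  have h2 : -1 ∈ symbSubgroup J := by
    change symb (-1) ∈ J
    rw [symb_neg_one]
    exact Ideal.subset_span (Set.mem_insert _ _)
  suffices h : symbSubgroup J = ⊤ from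
    fundIdeal_le_of_forall_symb_mem fun a => (h ▸ Subgroup.mem_top a : a ∈ symbSubgroup J)
  rw [eq_top_iff, ← hE, sup_le_iff, Subgroup.closure_le]
  refine ⟨fun e he => Ideal.subset_span (Set.mem_insert_of_mem _ ⟨e, he, rfl⟩), ?_⟩
  have hsq : ∀ c : Fˣ, c ∈ sumsOfSquares F 0 → c ∈ symbSubgroup J := by
    intro c hc
    have := two_pow_mul_symb hc
    rw [pow_zero, one_mul] at this
    change symb c ∈ J
    rw [this]
    exact J.zero_mem
  rintro c (hc | hc)
  · exact hsq c hc
  · simpa using (symbSubgroup J).mul_mem h2 (hsq _ hc)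

theorem fundIdeal_pow_le_span {E : Finset Fˣ}
    (hE : Subgroup.closure (E : Set Fˣ) ⊔ pmSumsOfSquares F 0 = ⊤) (k : ℕ) :
    fundIdeal F ^ k ≤ Ideal.span (symbolGens E k) := by
  classical
  induction k with
  | zero =>
    rw [(Ideal.eq_top_iff_one _).mpr (Ideal.subset_span
      (show (1 : WittRing F) ∈ symbolGens E 0 from ⟨0, ∅, by simp⟩))]
    exact le_top
  | succ k ih =>
    rw [pow_succ]
    refine (Ideal.mul_mono ih (fundIdeal_le_span hE)).trans ?_
    rw [Ideal.span_mul_span', Ideal.span_le]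
    rintro _ ⟨_, ⟨m, S, hS, hk, rfl⟩, y, hy, rfl⟩
    obtain rfl | ⟨e, he, rfl⟩ := hy
    · exact Ideal.subset_span ⟨m + 1, S, hS, by omega, by simp only; ring⟩
    -- If e already occurs, the new factor `symb e` turns into a 2: m grows and S stays the same.
    · by_cases heS : e ∈ S
      · refine Ideal.subset_span ⟨m + 1, S, hS, by omega, ?_⟩
        simp only
        rw [← Finset.mul_prod_erase S _ heS]
        linear_combination (2 ^ m * ∏ x ∈ S.erase e, symb x) * symb_mul_self e
      · refine Ideal.subset_span ⟨m, insert e S, Finset.insert_subset he hS, ?_, ?_⟩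
        · rw [Finset.card_insert_of_notMem heS]
          omega
        · simp only
          rw [Finset.prod_insert heS]
          ring

theorem symbolGens_subset_fundIdeal_pow (E : Finset Fˣ) (k : ℕ) :
    symbolGens E k ⊆ (fundIdeal F ^ k : Ideal (WittRing F)) := by
  rintro _ ⟨m, S, -, rfl, rfl⟩
  rw [pow_add]
  refine Ideal.mul_mem_mul (Ideal.pow_mem_pow (symb_neg_one (F := F) ▸ symb_mem_fundIdeal _) m) ?_
  rw [← Finset.prod_const]
  exact Ideal.prod_mem_prod fun e _ => symb_mem_fundIdeal e

theorem exists_mem_GP_of_mem_symbolGens {E : Finset Fˣ} {n : ℕ} {x : WittRing F}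
    (hx : x ∈ symbolGens E n) : ∃ q ∈ GP F n, toWitt q = x := by
  obtain ⟨m, S, -, rfl, rfl⟩ := hx
  -- The slots are m copies of 1 and then the -e, because ⟨1, 1⟩ has class 2 and ⟨1, -e⟩ has class
  -- `symb e`.
  refine ⟨_, ⟨1, fun i => Fin.append (fun _ : Fin m => (1 : Fˣ))
    (fun j : Fin S.card => -(S.equivFin.symm j : Fˣ)) i, rfl⟩, ?_⟩
  rw [map_mul, toWitt_diag_one, one_mul, pfister, map_prod, Fin.prod_univ_add]
  congr 1
  · simp only [Fin.append_left, map_add, toWitt_diag_one, Finset.prod_const, Finset.card_univ,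
      Fintype.card_fin]
    norm_num
  · simp only [Fin.append_right, ← symb_eq_toWitt]
    rw [S.equivFin.symm.prod_comp (fun e : S => symb (e : Fˣ)), Finset.prod_coe_sort]

/-- If every element of a ring is congruent to `0` or `1` modulo `I`, then every element of the
ideal spanned by a finite set `T` is a subsum of `T` modulo `I * span T`. -/
theorem exists_subset_sub_sum_mem {R : Type*} [CommRing R] {I : Ideal R}
    (hI : ∀ r, r ∈ I ∨ r - 1 ∈ I) (T : Finset R) {x : R} (hx : x ∈ Ideal.span (T : Set R)) :
    ∃ T' ⊆ T, x - ∑ t ∈ T', t ∈ I * Ideal.span (T : Set R) := by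
  classical
  obtain ⟨f, -, rfl⟩ := Submodule.mem_span_finset.mp hx
  -- The terms kept are those whose coefficient is congruent to 1 modulo I.
  refine ⟨T.filter fun t => f t ∉ I, Finset.filter_subset _ _, ?_⟩
  rw [Finset.sum_filter, ← Finset.sum_sub_distrib]
  refine Ideal.sum_mem _ fun t ht => ?_
  have hmem : t ∈ Ideal.span (T : Set R) := Ideal.subset_span ht
  split_ifs with h
  · rw [sub_zero]
    exact Ideal.mul_mem_mul h hmem
  · rw [smul_eq_mul, ← sub_one_mul]
    exact Ideal.mul_mem_mul ((hI _).resolve_left h) hmem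

open Classical in
/-- The bound on the symbol length given by a generating set adapted to the groups `D_F(2 ^ m)`. -/
theorem fieldSymbolLength_le_of_generators {E : Finset Fˣ} {n M : ℕ} {b : ℕ → ℕ}
    (hE : Subgroup.closure (E : Set Fˣ) ⊔ pmSumsOfSquares F 0 = ⊤)
    (hb : ∀ m ≤ n, (E.filter (· ∉ sumsOfSquares F m)).card ≤ b m) (hMn : M ≤ n)
    (hM : M = n ∨ (2 : WittRing F) ^ (M + 1) = 0) :
    fieldSymbolLength F n ≤ ((∑ m ∈ Finset.range (M + 1), (b m).choose (n - m) : ℕ) : ℕ∞) := by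
  -- The products not known to vanish. Coincidences among them only lower the cardinality.
  set T : Finset (WittRing F) := (Finset.range (M + 1)).biUnion fun m =>
    ((E.filter (· ∉ sumsOfSquares F m)).powersetCard (n - m)).image
      fun S => 2 ^ m * ∏ e ∈ S, symb e with hTdef
  have hTcard : T.card ≤ ∑ m ∈ Finset.range (M + 1), (b m).choose (n - m) := by
    refine Finset.card_biUnion_le.trans (Finset.sum_le_sum fun m hm => ?_)
    refine Finset.card_image_le.trans ?_
    rw [Finset.card_powersetCard]
    exact Nat.choose_le_choose _ (hb m (by have := Finset.mem_range.mp hm; omega))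
  have hTgen : (T : Set (WittRing F)) ⊆ symbolGens E n := by
    intro x hx
    simp only [hTdef, Finset.mem_coe, Finset.mem_biUnion, Finset.mem_image,
      Finset.mem_powersetCard, Finset.mem_range] at hx
    obtain ⟨m, hm, S, ⟨hS, hc⟩, rfl⟩ := hx
    exact ⟨m, S, hS.trans (Finset.filter_subset _ _), by omega, rfl⟩
  have hspan : fundIdeal F ^ n ≤ Ideal.span (T : Set (WittRing F)) := by
    refine (fundIdeal_pow_le_span hE n).trans (Ideal.span_le.mpr ?_)
    rintro _ ⟨m, S, hS, hk, rfl⟩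
    by_cases hmM : m ≤ M
    · by_cases hD : ∀ e ∈ S, e ∉ sumsOfSquares F m
      · refine Ideal.subset_span ?_
        simp only [hTdef, Finset.mem_coe, Finset.mem_biUnion, Finset.mem_image,
          Finset.mem_powersetCard, Finset.mem_range]
        exact ⟨m, by omega, S, ⟨fun e he => Finset.mem_filter.mpr ⟨hS he, hD e he⟩, by omega⟩, rfl⟩
      · push Not at hD
        obtain ⟨e, he, hD⟩ := hD
        rw [← Finset.mul_prod_erase S _ he, ← mul_assoc, two_pow_mul_symb hD, zero_mul]
        exact Ideal.zero_mem _
    -- Here M < m ≤ n excludes M = n.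
    · have h0 : (2 : WittRing F) ^ (M + 1) = 0 := hM.resolve_left (by omega)
      rw [show m = M + 1 + (m - (M + 1)) by omega, pow_add, h0, zero_mul, zero_mul]
      exact Ideal.zero_mem _
  refine iSup₂_le fun φ hφ => ?_
  obtain ⟨T', hT', hmem⟩ := exists_subset_sub_sum_mem mem_fundIdeal_or T (hspan hφ)
  have hsum : IsSumOfSymbols n T'.card φ := by
    choose! q hq hqx using fun x (hx : x ∈ symbolGens E n) => exists_mem_GP_of_mem_symbolGens hx
    have hgen : ∀ i, (T'.equivFin.symm i : WittRing F) ∈ symbolGens E n := fun i =>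
      hTgen (hT' (T'.equivFin.symm i).2)
    refine ⟨fun i => q (T'.equivFin.symm i), fun i => hq _ (hgen i), ?_⟩
    simp_rw [hqx _ (hgen _)]
    rw [T'.equivFin.symm.sum_comp (fun t : T' => (t : WittRing F)),
      Finset.sum_coe_sort T' (fun t => t), pow_succ']
    -- T lies in IⁿF, so the error term in IF · span T lies in Iⁿ⁺¹F.
    exact Ideal.mul_mono_right (Ideal.span_le.mpr
      (hTgen.trans (symbolGens_subset_fundIdeal_pow E n))) hmem
  refine (iInf₂_le (f := fun (k : ℕ) (_ : IsSumOfSymbols n k φ) => (k : ℕ∞)) _ hsum).trans ?_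
  exact_mod_cast (Finset.card_le_card hT').trans hTcard

end Span

/-! ### Generators of F^× adapted to the chain of groups D_F(2^m) -/

section AdaptedGenerators

variable (F : Type u) [Field F]

theorem sumsOfSquares_mono : Monotone (sumsOfSquares F) := by
  refine monotone_nat_of_le_succ fun m => ?_
  rintro c ⟨x, hx⟩
  have hr : 2 ^ (m + 1) = 2 ^ m + 2 ^ m := by ring
  refine ⟨fun i => Fin.append x (0 : Fin (2 ^ m) → F) (Fin.cast hr i), ?_⟩
  rw [hx, ← (finCongr hr).symm.sum_comp, Fin.sum_univ_add]
  simp [-Fin.natAdd_eq_addNat]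

theorem pmSumsOfSquares_mono : Monotone (pmSumsOfSquares F) := fun _ _ h _ hc =>
  hc.imp (fun hc => sumsOfSquares_mono F h hc) fun hc => sumsOfSquares_mono F h hc

/-- Every ±D_F(2^m) contains the squares. Finiteness ensures that `dInv` is a genuine dimension, not
the default 0 of `finrank`. -/
theorem finite_quotient_pmSumsOfSquares [Finite (Fˣ ⧸ Subgroup.square Fˣ)] (m : ℕ) :
    Finite (Additive (Fˣ ⧸ pmSumsOfSquares F m)) := by
  have hle : Subgroup.square Fˣ ≤ pmSumsOfSquares F m := by
    rintro _ ⟨c, rfl⟩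
    rw [← sq]
    exact sq_mem_pmSumsOfSquares F m c
  exact Finite.of_surjective
    (fun x => Additive.ofMul (QuotientGroup.map _ _ (MonoidHom.id Fˣ) hle x))
    (Additive.ofMul.surjective.comp
      (QuotientGroup.map_surjective_of_surjective _ _ _
        (QuotientGroup.mk_surjective.comp Function.surjective_id) hle))

/-- The units whose class modulo `±D_F(2 ^ m)` lies in a given subspace. -/
def unitsOver (m : ℕ) (U : Submodule (ZMod 2) (Additive (Fˣ ⧸ pmSumsOfSquares F m))) :
    Subgroup Fˣ where
  carrier := {a | Additive.ofMul (a : Fˣ ⧸ pmSumsOfSquares F m) ∈ U}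
  one_mem' := U.zero_mem
  mul_mem' ha hb := U.add_mem ha hb
  inv_mem' ha := U.neg_mem ha

/-- A subspace of `F^× / ±D_F(2 ^ m)` is generated by at most as many units as its dimension. -/
theorem exists_generators_unitsOver (m : ℕ)
    [Finite (Additive (Fˣ ⧸ pmSumsOfSquares F m))]
    (U : Submodule (ZMod 2) (Additive (Fˣ ⧸ pmSumsOfSquares F m))) :
    ∃ E : Finset Fˣ, (E : Set Fˣ) ⊆ unitsOver F m U ∧ E.card ≤ Module.finrank (ZMod 2) U ∧
      unitsOver F m U ≤ Subgroup.closure (E : Set Fˣ) ⊔ pmSumsOfSquares F m := by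
  classical
  let b := Module.finBasis (ZMod 2) U
  choose r hr using fun i =>
    QuotientGroup.mk_surjective ((b i : U) : Additive (Fˣ ⧸ pmSumsOfSquares F m)).toMul
  refine ⟨Finset.univ.image r, ?_, Finset.card_image_le.trans (by simp), ?_⟩
  · intro e he
    obtain ⟨i, -, rfl⟩ := Finset.mem_image.mp he
    change Additive.ofMul (r i : Fˣ ⧸ pmSumsOfSquares F m) ∈ U
    rw [hr]
    exact (b i).2
  · intro a ha
    set K := Subgroup.closure ((Finset.univ.image r : Finset Fˣ) : Set Fˣ) ⊔ pmSumsOfSquares F m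
    -- Quantifying over all lifts a of x lets the addition case choose a lift c of one summand and
    -- use c⁻¹a for the other.
    have key : ∀ x ∈ Submodule.span (ZMod 2)
        (Set.range fun i => ((b i : U) : Additive (Fˣ ⧸ pmSumsOfSquares F m))),
        ∀ a : Fˣ, Additive.ofMul (a : Fˣ ⧸ pmSumsOfSquares F m) = x → a ∈ K := by
      intro x hx
      induction hx using Submodule.span_induction with
      | mem x h =>
        obtain ⟨i, rfl⟩ := h
        intro a ha
        have : (r i : Fˣ ⧸ pmSumsOfSquares F m) = a := by
          rw [hr]
          exact (congrArg Additive.toMul ha).symm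
        rw [QuotientGroup.eq] at this
        rw [← mul_inv_cancel_left (r i) a]
        exact K.mul_mem (le_sup_left (a := Subgroup.closure _)
          (Subgroup.subset_closure (by simp))) (le_sup_right (a := Subgroup.closure _) this)
      | zero =>
        intro a ha
        exact le_sup_right (a := Subgroup.closure _) ((QuotientGroup.eq_one_iff a).mp ha)
      | add x y _ _ hx hy =>
        intro a ha
        obtain ⟨c, hc⟩ := QuotientGroup.mk_surjective x.toMul
        have h1 := hx c (congrArg Additive.ofMul hc)
        have h2 := hy (c⁻¹ * a) (by
          rw [QuotientGroup.mk_mul, ofMul_mul, ha, QuotientGroup.mk_inv, hc, ofMul_inv, ofMul_toMul]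
          exact neg_add_cancel_left x y)
        simpa using K.mul_mem h1 h2
      | smul t x _ hx =>
        intro a ha
        obtain rfl | rfl : t = 0 ∨ t = 1 := by
          clear * -
          revert t
          decide
        · rw [zero_smul] at ha
          exact le_sup_right (a := Subgroup.closure _) ((QuotientGroup.eq_one_iff a).mp ha)
        · exact hx a (by rw [ha, one_smul])
    refine key (Additive.ofMul (a : Fˣ ⧸ pmSumsOfSquares F m)) ?_ a rfl
    have : Submodule.span (ZMod 2)
        (Set.range fun i => ((b i : U) : Additive (Fˣ ⧸ pmSumsOfSquares F m))) = U := by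
      have := congrArg (Submodule.map U.subtype) b.span_eq
      rwa [Submodule.map_span, Submodule.map_subtype_top, ← Set.range_comp] at this
    rw [this]
    exact ha

/-- The projection `F^× / ±D_F(2 ^ m) → F^× / ±D_F(2 ^ (m + 1))`. -/
def pmProjection (m : ℕ) : Additive (Fˣ ⧸ pmSumsOfSquares F m) →ₗ[ZMod 2]
    Additive (Fˣ ⧸ pmSumsOfSquares F (m + 1)) :=
  AddMonoidHom.toZModLinearMap 2 (MonoidHom.toAdditive
    (QuotientGroup.map _ _ (MonoidHom.id Fˣ) (pmSumsOfSquares_mono F m.le_succ)))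

theorem pmProjection_surjective (m : ℕ) : Function.Surjective (pmProjection F m) :=
  QuotientGroup.map_surjective_of_surjective _ _ _
    (QuotientGroup.mk_surjective.comp Function.surjective_id) (pmSumsOfSquares_mono F m.le_succ)

theorem unitsOver_ker_pmProjection (m : ℕ) :
    unitsOver F m (LinearMap.ker (pmProjection F m)) = pmSumsOfSquares F (m + 1) := by
  ext a
  exact QuotientGroup.eq_one_iff a

theorem finrank_ker_pmProjection (m : ℕ) [Finite (Additive (Fˣ ⧸ pmSumsOfSquares F m))] :
    dInv F (m + 1) + Module.finrank (ZMod 2) (LinearMap.ker (pmProjection F m)) = dInv F m := by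
  have h := (pmProjection F m).finrank_range_add_finrank_ker
  rwa [LinearMap.range_eq_top.mpr (pmProjection_surjective F m), finrank_top] at h

/-- Representatives of classes in `±D_F(2 ^ m)` can be chosen in `D_F(2 ^ m)`. -/
theorem exists_generators_pmSumsOfSquares_succ (m : ℕ)
    [Finite (Additive (Fˣ ⧸ pmSumsOfSquares F m))] :
    ∃ E : Finset Fˣ, (E : Set Fˣ) ⊆ sumsOfSquares F (m + 1) ∧
      dInv F (m + 1) + E.card ≤ dInv F m ∧
      pmSumsOfSquares F (m + 1) ≤ Subgroup.closure (E : Set Fˣ) ⊔ pmSumsOfSquares F m := by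
  classical
  obtain ⟨E, hE, hc, hle⟩ := exists_generators_unitsOver F m (LinearMap.ker (pmProjection F m))
  rw [unitsOver_ker_pmProjection] at hE hle
  -- A change of sign preserves the class modulo ±D_F(2^m). It is needed because `two_pow_mul_symb`
  -- requires membership in D_F(2^(m+1)) itself, not merely up to sign.
  let f : Fˣ → Fˣ := fun e => if e ∈ sumsOfSquares F (m + 1) then e else -e
  refine ⟨E.image f, ?_, ?_, hle.trans (sup_le ?_ le_sup_right)⟩
  · intro e he
    obtain ⟨c, hcE, rfl⟩ := Finset.mem_image.mp he
    by_cases h : c ∈ sumsOfSquares F (m + 1)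
    · simp [f, h]
    · simpa [f, h] using (hE hcE).resolve_left h
  · have := finrank_ker_pmProjection F m
    have := Finset.card_image_le (s := E) (f := f)
    omega
  · rw [Subgroup.closure_le]
    intro e he
    set K := Subgroup.closure ((E.image f : Finset Fˣ) : Set Fˣ) ⊔ pmSumsOfSquares F m
    have hf : f e ∈ K := le_sup_left (a := Subgroup.closure _)
      (Subgroup.subset_closure (Finset.mem_coe.mpr (Finset.mem_image_of_mem f he)))
    have hneg : -1 ∈ K := le_sup_right (a := Subgroup.closure _)
      (Or.inr (by simp))
    by_cases h : e ∈ sumsOfSquares F (m + 1)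
    · simpa [f, h] using hf
    · simpa [f, h] using K.mul_mem hneg hf

open Classical in
/-- There is a finite set of generators of `F^×` modulo `±F^{×2}`, at most `d_m` of which lie
outside `D_F(2 ^ m)`, for all `m ≤ n`. -/
theorem exists_adapted_generators [Finite (Fˣ ⧸ Subgroup.square Fˣ)] (n : ℕ) :
    ∃ E : Finset Fˣ, Subgroup.closure (E : Set Fˣ) ⊔ pmSumsOfSquares F 0 = ⊤ ∧
      ∀ m ≤ n, (E.filter (· ∉ sumsOfSquares F m)).card ≤ dInv F m := by
  have hfin := finite_quotient_pmSumsOfSquares F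
  suffices h : ∀ j ≤ n, ∃ E : Finset Fˣ,
      -- Descending induction from j = n to j = 0; the bound on the whole of E is what allows the
      -- next layer to be added.
      Subgroup.closure (E : Set Fˣ) ⊔ pmSumsOfSquares F j = ⊤ ∧ E.card ≤ dInv F j ∧
      ∀ m ≤ n, j ≤ m → (E.filter (· ∉ sumsOfSquares F m)).card ≤ dInv F m by
    obtain ⟨E, hE, -, hc⟩ := h 0 (Nat.zero_le n)
    exact ⟨E, hE, fun m hm => hc m hm (Nat.zero_le m)⟩
  intro j hj
  induction hj using Nat.decreasingInduction with
  | self =>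
    obtain ⟨E, -, hc, hle⟩ := exists_generators_unitsOver F n ⊤
    rw [finrank_top] at hc
    refine ⟨E, top_unique fun a _ => hle (show a ∈ unitsOver F n ⊤ from trivial), hc,
      fun m hm hm' => ?_⟩
    obtain rfl := le_antisymm hm hm'
    exact (Finset.card_filter_le _ _).trans hc
  | of_succ j hj ih =>
    obtain ⟨E, hE, hc, hm⟩ := ih
    obtain ⟨E', hE', hc', hle⟩ := exists_generators_pmSumsOfSquares_succ F j
    have hcard : (E ∪ E').card ≤ dInv F j := by
      have := Finset.card_union_le E E'
      omega
    refine ⟨E ∪ E', top_unique ?_, hcard, fun m hmn hjm => ?_⟩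
    · rw [← hE, Finset.coe_union, Subgroup.closure_union]
      exact sup_le (le_sup_left.trans le_sup_left)
        (hle.trans (sup_le_sup_right le_sup_right _))
    · obtain rfl | hlt := hjm.eq_or_lt
      · exact (Finset.card_filter_le _ _).trans hcard
      -- The new generators lie in D_F(2^(j+1)) ⊆ D_F(2^m), so they do not contribute to the count
      -- for m > j.
      · refine le_trans (Finset.card_le_card ?_) (hm m hmn hlt)
        intro e he
        obtain ⟨he, hD⟩ := Finset.mem_filter.mp he
        refine Finset.mem_filter.mpr ⟨(Finset.mem_union.mp he).resolve_right fun h => ?_, hD⟩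
        exact hD (sumsOfSquares_mono F hlt (hE' h))

end AdaptedGenerators

end WittTheory

end

/-! ### The two bounds -/

open WittTheory in
theorem mainTheorem4 (F : Type u) [Field F] [Invertible (2 : F)] (d : ℕ)
    (hd : Nat.card (Fˣ ⧸ Subgroup.square Fˣ) = 2 ^ d) (n : ℕ) (hn : 1 ≤ n) :
    (∀ s : ℕ, level F = 2 ^ s →
      fieldSymbolLength F n ≤
        ((∑ m ∈ Finset.range (min s n + 1), (dInv F m).choose (n - m) : ℕ) : ℕ∞)) ∧
    (IsFormallyReal F →
      fieldSymbolLength F n ≤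
        ((∑ m ∈ Finset.range (n + 1), (dInv F m).choose (n - m) : ℕ) : ℕ∞)) := by
  -- `Nat.card` of an infinite type is 0, so the value 2^d forces finiteness.
  have hfin : Finite (Fˣ ⧸ Subgroup.square Fˣ) :=
    Nat.finite_of_card_ne_zero (by rw [hd]; positivity)
  obtain ⟨E, hE, hc⟩ := exists_adapted_generators F n
  refine ⟨fun s hs => ?_, fun _ => ?_⟩
  · refine fieldSymbolLength_le_of_generators hE hc (min_le_right _ _) ?_
    -- For s ≤ n the sum is cut off at s by 2^(s+1) = 0; for s ≥ n all m ≤ n are present.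
    obtain h | h := le_total s n
    · right
      rw [min_eq_left h]
      exact two_pow_eq_zero_of_level F hs
    · exact .inl (min_eq_right h)
  · exact fieldSymbolLength_le_of_generators hE hc le_rfl (.inl rfl)
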